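/- Let $\Phi$ be a (finite) reduced crystallographic root system in a vector space over a field of characteristic zero, with Weyl group $W$ and a fixed base of simple roots; let $\Phi^+$ be the corresponding set of positive roots, $2\rho=\sum_{\alpha\in\Phi^+}\alpha$, and let $\ell$ be the length function on $W$ with respect to the simple reflections. The quantum Bruhat graph is the directed graph with vertex set $W$ and with an edge $w\to ws_\alpha$, for $w\in W$ and $\alpha\in\Phi^+$, whenever either $\ell(ws_\alpha)=\ell(w)+1$ (an upward edge) or $\ell(ws_\alpha)=\ell(w)-\langle 2\rho,\alpha^\vee\rangle+1$ (a downward edge). For $w\in W$ let $d_\Gamma(w,1)$ be the minimal number of edges of a directed path from $w$ to $1$ in this graph, and let $d_{\downarrow}(w)$ be the minimal number of edges of a directed path from $w$ to $1$ that uses only downward edges. Then, for every $w\in W$, a path from $w$ to $1$ using only downward edges exists, and $$d_\Gamma(w,1)=d_{\downarrow}(w).$$ -/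

import Mathlib

namespace QuantumBruhat

noncomputable section

open Classical in
/-- The sum `2ρ` of the positive roots of `P` relative to the base `b`. -/
def twoRho {ι R M N : Type*} [Fintype ι] [CommRing R] [CharZero R] [AddCommGroup M] [Module R M]
    [AddCommGroup N] [Module R N] {P : RootPairing ι R M N} (b : P.Base) : M :=
  ∑ i : ι with b.IsPos i, P.root i

/-- The length of an element `w` of the Weyl group: the smallest length of a word in the simple
reflections whose product is `w`. -/
def length {ι R M N : Type*} [CommRing R] [AddCommGroup M] [Module R M]
    [AddCommGroup N] [Module R N] {P : RootPairing ι R M N} (b : P.Base) (w : P.weylGroup) : ℕ :=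
  sInf {n : ℕ | ∃ l : List ι, (∀ i ∈ l, i ∈ b.support) ∧
    (l.map (RootPairing.weylGroup.ofIdx P)).prod = w ∧ l.length = n}

/-- Upward edges `w ⟶ w s_α`: those with `α` a positive root and `ℓ(w s_α) = ℓ(w) + 1`. -/
def IsUpwardEdge {ι R M N : Type*} [CommRing R] [CharZero R] [AddCommGroup M] [Module R M]
    [AddCommGroup N] [Module R N] {P : RootPairing ι R M N} (b : P.Base)
    (w v : P.weylGroup) : Prop :=
  ∃ α : ι, b.IsPos α ∧ v = w * RootPairing.weylGroup.ofIdx P α ∧ length b v = length b w + 1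

/-- Downward edges `w ⟶ w s_α`: those with `α` a positive root and
`ℓ(w s_α) = ℓ(w) - ⟨2ρ, α^∨⟩ + 1`. The equation is between scalars. -/
def IsDownwardEdge {ι R M N : Type*} [Fintype ι] [CommRing R] [CharZero R] [AddCommGroup M]
    [Module R M] [AddCommGroup N] [Module R N] {P : RootPairing ι R M N} (b : P.Base)
    (w v : P.weylGroup) : Prop :=
  ∃ α : ι, b.IsPos α ∧ v = w * RootPairing.weylGroup.ofIdx P α ∧
    (length b v : R) = (length b w : R) - P.toLinearMap (twoRho b) (P.coroot α) + 1

/-- The quantum Bruhat graph (with edge labels forgotten). -/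
def quantumBruhatGraph {ι R M N : Type*} [Fintype ι] [CommRing R] [CharZero R] [AddCommGroup M]
    [Module R M] [AddCommGroup N] [Module R N] {P : RootPairing ι R M N} (b : P.Base) :
    Digraph P.weylGroup where
  Adj w v := IsUpwardEdge b w v ∨ IsDownwardEdge b w v

/-- The subgraph of the quantum Bruhat graph consisting of all vertices and the downward edges. -/
def downwardGraph {ι R M N : Type*} [Fintype ι] [CommRing R] [CharZero R] [AddCommGroup M]
    [Module R M] [AddCommGroup N] [Module R N] {P : RootPairing ι R M N} (b : P.Base) :
    Digraph P.weylGroup where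
  Adj w v := IsDownwardEdge b w v

/-- `HasPath G u v n`: there is a directed path with exactly `n` edges from `u` to `v` in `G`. -/
inductive HasPath {V : Type*} (G : Digraph V) : V → V → ℕ → Prop
  | nil (u : V) : HasPath G u u 0
  | cons {u v w : V} {n : ℕ} (h : G.Adj u v) (p : HasPath G v w n) : HasPath G u w (n + 1)

/-- The minimal number of edges of a directed path from `u` to `v` in `G`, with value `⊤` when
there is no such path. -/
def pathDist {V : Type*} (G : Digraph V) (u v : V) : ℕ∞ :=
  ⨅ (n : ℕ) (_ : HasPath G u v n), (n : ℕ∞)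

end

end QuantumBruhat

/-! Downward paths exist by stripping last letters off a reduced word, since ⟨2ρ, α^∨⟩ = 2 for α
simple. For minimality, upward edges are removed from a path, the last one first, without
lengthening it. Let w → v → u go up with label α, then down with label β. By `length_ofIdx_lt` and
subadditivity of length, the downward edge forces ℓ(s_β) = ⟨2ρ, β^∨⟩ - 1. If s_β α > 0, the edges
swap and induction on the path length applies. Otherwise `eq_or_pairingIn_eq_one_of_quantum` leaves
α = β, so that w = u, or ⟨α, β^∨⟩ = 1. In the latter case s_β s_α = s_x s_y with no larger total
⟨2ρ, ·^∨⟩ (`exists_mul_ofIdx_eq`), and w → u s_x → u are both downward because the lengths leave no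
slack. -/

namespace QuantumBruhat

open RootPairing

/-! ### Reflections, heights and length in the Weyl group -/

section

variable {ι K M N : Type*} [Field K]
  [AddCommGroup M] [Module K M] [AddCommGroup N] [Module K N]
  {P : RootPairing ι K M N}

lemma ofIdx_mul_self (i : ι) : weylGroup.ofIdx P i * weylGroup.ofIdx P i = 1 := by
  rw [mul_eq_one_iff_eq_inv]
  exact Subtype.ext (Equiv.reflection_inv P i).symm

lemma ofIdx_mul_self_assoc (i : ι) (w : P.weylGroup) :
    weylGroup.ofIdx P i * (weylGroup.ofIdx P i * w) = w := by
  rw [← mul_assoc, ofIdx_mul_self, one_mul]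

lemma ofIdx_inv (i : ι) : (weylGroup.ofIdx P i)⁻¹ = weylGroup.ofIdx P i :=
  inv_eq_of_mul_eq_one_left (ofIdx_mul_self i)

lemma ofIdx_smul_idx (i j : ι) : weylGroup.ofIdx P i • j = P.reflectionPerm i j := rfl

lemma root_smul (w : P.weylGroup) (i : ι) : P.root (w • i) = w • P.root i :=
  (weylGroup_apply_root P w i).symm

lemma ofIdx_reflectionPerm (i j : ι) :
    weylGroup.ofIdx P (P.reflectionPerm j i) =
      weylGroup.ofIdx P j * weylGroup.ofIdx P i * weylGroup.ofIdx P j := by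
  apply Subtype.ext
  apply Equiv.weightHom_injective P
  have h (k : ι) : Equiv.weightHom P (weylGroup.ofIdx P k : Aut P) = P.reflection k :=
    Equiv.reflection_weightEquiv P k
  simp only [Subgroup.coe_mul, map_mul, h, reflection_reflectionPerm]

lemma ofIdx_neg (i : ι) :
    weylGroup.ofIdx P (P.reflectionPerm i i) = weylGroup.ofIdx P i := by
  rw [ofIdx_reflectionPerm, ofIdx_mul_self, one_mul]

/-- Conjugating a reflection by a Weyl group element. -/
lemma ofIdx_smul (w : P.weylGroup) (i : ι) :
    weylGroup.ofIdx P (w • i) * w = w * weylGroup.ofIdx P i := by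
  obtain ⟨w, hw⟩ := w
  induction hw using weylGroup.induction generalizing i with
  | mem j =>
    change weylGroup.ofIdx P (P.reflectionPerm j i) * weylGroup.ofIdx P j = _
    rw [ofIdx_reflectionPerm, mul_assoc, ofIdx_mul_self, mul_one]
    rfl
  | one =>
    change weylGroup.ofIdx P ((1 : P.weylGroup) • i) * 1 = 1 * _
    rw [one_smul, mul_one, one_mul]
  | mul x y hx hy ihx ihy =>
    change weylGroup.ofIdx P (((⟨x, hx⟩ : P.weylGroup) * ⟨y, hy⟩) • i) * (⟨x, hx⟩ * ⟨y, hy⟩) =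
      (⟨x, hx⟩ * ⟨y, hy⟩) * weylGroup.ofIdx P i
    rw [mul_smul, ← mul_assoc, ihx, mul_assoc, ihy, mul_assoc]

lemma smul_reflectionPerm_self (w : P.weylGroup) (i : ι) :
    w • P.reflectionPerm i i = P.reflectionPerm (w • i) (w • i) := by
  apply P.root.injective
  rw [root_smul, root_reflectionPerm, root_reflectionPerm, reflection_apply_self,
    reflection_apply_self, root_smul]
  exact smul_neg w (P.root i)

variable [CharZero K] (b : P.Base)

lemma isPos_neg_iff (i : ι) : b.IsPos (P.reflectionPerm i i) ↔ ¬ b.IsPos i :=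
  Base.IsPos.neg_iff_not b i

lemma height_neg (i : ι) : b.height (P.reflectionPerm i i) = - b.height i :=
  b.height_reflectionPerm_self i

lemma height_reflectionPerm [P.IsCrystallographic] (i j : ι) :
    b.height (P.reflectionPerm i j) = b.height j - P.pairingIn ℤ j i * b.height i := by
  have : P.root (P.reflectionPerm i j) = P.root j + (-P.pairingIn ℤ j i) • P.root i := by
    rw [root_reflectionPerm, neg_smul, reflection_apply_root' ℤ, sub_eq_add_neg]
  rw [b.height_add_zsmul this, smul_eq_mul]
  ring

/-- A positive root is simple, or is lowered by a simple reflection to another positive root. -/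
lemma isPos_induction_on_simple [Finite ι] [P.IsCrystallographic] [P.IsReduced] {b : P.Base}
    {p : ι → Prop} (h₁ : ∀ i ∈ b.support, p i)
    (h₂ : ∀ i j, b.IsPos i → j ∈ b.support → b.IsPos (P.reflectionPerm j i) →
      0 < P.pairingIn ℤ j i → p (P.reflectionPerm j i) → p i) {i : ι} (hi : b.IsPos i) : p i := by
  generalize hN : (b.height i).toNat = N
  induction N using Nat.strong_induction_on generalizing i with
  | h n ih =>
    obtain ⟨j, hj, hj'⟩ := hi.exists_mem_support_pos_pairingIn
    rcases eq_or_ne i j with rfl | hij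
    · exact h₁ i hj
    have hk := hi.reflectionPerm hj hij
    refine h₂ i j hi hj hk hj' (ih _ ?_ hk rfl)
    have hht := height_reflectionPerm b j i
    rw [Base.height_one_of_mem_support hj] at hht
    rw [P.zero_lt_pairingIn_iff'] at hj'
    rw [Base.isPos_iff] at hi hk
    lia

/-! ### The length function -/

section Length

variable [Finite ι] [P.IsCrystallographic] [P.IsReduced]

lemma exists_word (w : P.weylGroup) :
    ∃ l : List ι, (∀ i ∈ l, i ∈ b.support) ∧ (l.map (weylGroup.ofIdx P)).prod = w := by
  obtain ⟨w, hw⟩ := w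
  induction hw using weylGroup.induction with
  | mem i =>
    refine b.induction_reflect (p := fun i ↦ ∃ l : List ι, (∀ i ∈ l, i ∈ b.support) ∧
      (l.map (weylGroup.ofIdx P)).prod = weylGroup.ofIdx P i) i ?_ ?_ ?_
    · intro i hi
      rwa [ofIdx_neg]
    · exact fun i hi ↦ ⟨[i], by simpa, by simp⟩
    · rintro i j ⟨l, hl, hp⟩ hj
      refine ⟨j :: (l ++ [j]), ?_, ?_⟩
      · simpa [or_imp, forall_and, hj] using hl
      · simp [hp, ofIdx_reflectionPerm, mul_assoc]
  | one => exact ⟨[], by simp, rfl⟩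
  | mul x y hx hy ihx ihy =>
    obtain ⟨l, hl, hp⟩ := ihx
    obtain ⟨l', hl', hp'⟩ := ihy
    refine ⟨l ++ l', ?_, ?_⟩
    · intro i hi
      rcases List.mem_append.1 hi with h | h
      exacts [hl i h, hl' i h]
    · rw [List.map_append, List.prod_append, hp, hp']
      rfl

lemma exists_reduced_word (w : P.weylGroup) :
    ∃ l : List ι, (∀ i ∈ l, i ∈ b.support) ∧ (l.map (weylGroup.ofIdx P)).prod = w ∧
      l.length = length b w := by
  obtain ⟨l, hl, hp⟩ := exists_word b w
  exact Nat.sInf_mem (s := {n : ℕ | ∃ l : List ι, (∀ i ∈ l, i ∈ b.support) ∧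
    (l.map (weylGroup.ofIdx P)).prod = w ∧ l.length = n}) ⟨_, l, hl, hp, rfl⟩

omit [CharZero K] [Finite ι] [P.IsCrystallographic] [P.IsReduced] in
lemma length_prod_le {l : List ι} (hl : ∀ i ∈ l, i ∈ b.support) :
    length b (l.map (weylGroup.ofIdx P)).prod ≤ l.length :=
  Nat.sInf_le ⟨l, hl, rfl, rfl⟩

omit [CharZero K] [Finite ι] [P.IsCrystallographic] [P.IsReduced] in
lemma length_one : length b (1 : P.weylGroup) = 0 :=
  Nat.le_zero.1 (length_prod_le b (l := []) (by simp))

omit [CharZero K] [Finite ι] [P.IsCrystallographic] [P.IsReduced] in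
lemma length_ofIdx_le_one {j : ι} (hj : j ∈ b.support) :
    length b (weylGroup.ofIdx P j) ≤ 1 := by
  simpa using length_prod_le b (l := [j]) (by simpa)

lemma length_mul_le (x y : P.weylGroup) : length b (x * y) ≤ length b x + length b y := by
  obtain ⟨l, hl, rfl, hn⟩ := exists_reduced_word b x
  obtain ⟨l', hl', rfl, hn'⟩ := exists_reduced_word b y
  rw [← hn, ← hn', ← List.prod_append, ← List.map_append, ← List.length_append]
  refine length_prod_le b fun i hi ↦ ?_
  rcases List.mem_append.1 hi with h | h
  exacts [hl i h, hl' i h]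

/-- The strong exchange condition. -/
lemma exists_shorter_word (l : List ι) (hl : ∀ i ∈ l, i ∈ b.support) {α : ι} (hα : b.IsPos α)
    (h : ¬ b.IsPos ((l.map (weylGroup.ofIdx P)).prod • α)) :
    ∃ l' : List ι, (∀ i ∈ l', i ∈ b.support) ∧ l'.length < l.length ∧
      (l'.map (weylGroup.ofIdx P)).prod =
        (l.map (weylGroup.ofIdx P)).prod * weylGroup.ofIdx P α := by
  induction l with
  | nil => exact absurd hα (by simpa using h)
  | cons j t ih =>
    rw [List.forall_mem_cons] at hl
    -- If α turns negative exactly at the letter j, then t carries α to the simple root j, and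
    -- deleting j amounts to right multiplication by s_α.
    by_cases ht : b.IsPos ((t.map (weylGroup.ofIdx P)).prod • α)
    · refine ⟨t, hl.2, by simp, ?_⟩
      have hj : (t.map (weylGroup.ofIdx P)).prod • α = j := by
        by_contra hne
        refine h ?_
        rw [List.map_cons, List.prod_cons, mul_smul]
        exact ht.reflectionPerm hl.1 hne
      rw [List.map_cons, List.prod_cons, mul_assoc, ← ofIdx_smul, hj, ofIdx_mul_self_assoc]
    · obtain ⟨t', ht', hlen, hp⟩ := ih hl.2 ht
      refine ⟨j :: t', by simpa using ⟨hl.1, ht'⟩, by simpa, ?_⟩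
      simp only [List.map_cons, List.prod_cons, hp, mul_assoc]

lemma length_mul_ofIdx_lt {w : P.weylGroup} {α : ι} (hα : b.IsPos α) (h : ¬ b.IsPos (w • α)) :
    length b (w * weylGroup.ofIdx P α) < length b w := by
  obtain ⟨l, hl, rfl, hn⟩ := exists_reduced_word b w
  obtain ⟨l', hl', hlen, hp⟩ := exists_shorter_word b l hl hα h
  rw [← hn, ← hp]
  exact (length_prod_le b hl').trans_lt hlen

lemma not_isPos_smul_of_length_lt {w : P.weylGroup} {α : ι} (hα : b.IsPos α)
    (h : length b (w * weylGroup.ofIdx P α) < length b w) : ¬ b.IsPos (w • α) := by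
  intro hpos
  have := length_mul_ofIdx_lt b (w := w * weylGroup.ofIdx P α) hα ?_
  · rw [mul_assoc, ofIdx_mul_self, mul_one] at this
    exact lt_asymm h this
  · rwa [mul_smul, ofIdx_smul_idx, smul_reflectionPerm_self, isPos_neg_iff, not_not]

end Length

end

/-! ### The pairing with 2ρ and quantum roots -/

section

variable {ι K M N : Type*} [Fintype ι] [Field K] [CharZero K]
  [AddCommGroup M] [Module K M] [AddCommGroup N] [Module K N]
  {P : RootPairing ι K M N} [P.IsCrystallographic] (b : P.Base)

open Classical in
/-- The integer `⟨2ρ, β^∨⟩`. -/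
noncomputable def twoRhoPairing (β : ι) : ℤ := ∑ i : ι with b.IsPos i, P.pairingIn ℤ i β

lemma twoRhoPairing_cast (β : ι) :
    (twoRhoPairing b β : K) = P.toLinearMap (twoRho b) (P.coroot β) := by
  simp only [twoRhoPairing, twoRho, map_sum, LinearMap.coe_sum, Finset.sum_apply, Int.cast_sum]
  refine Finset.sum_congr rfl fun i _ ↦ ?_
  rw [root_coroot_eq_pairing, ← P.algebraMap_pairingIn ℤ]
  rfl

lemma twoRhoPairing_reflectionPerm (i j : ι) :
    twoRhoPairing b (P.reflectionPerm i j) =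
      twoRhoPairing b j - P.pairingIn ℤ i j * twoRhoPairing b i := by
  have h : (P.pairingIn ℤ i j : K) = P.pairing i j := P.algebraMap_pairingIn ℤ i j
  apply Int.cast_injective (α := K)
  push_cast
  simp only [twoRhoPairing_cast, ← P.reflectionPerm_coroot, h, map_sub, map_smul, smul_eq_mul,
    root_coroot_eq_pairing]

lemma twoRhoPairing_neg (i : ι) :
    twoRhoPairing b (P.reflectionPerm i i) = - twoRhoPairing b i := by
  rw [twoRhoPairing_reflectionPerm, P.pairingIn_same ℤ]
  ring

lemma isDownwardEdge_iff {w v : P.weylGroup} :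
    IsDownwardEdge b w v ↔ ∃ α : ι, b.IsPos α ∧ v = w * weylGroup.ofIdx P α ∧
      (length b v : ℤ) = length b w - twoRhoPairing b α + 1 := by
  simp only [IsDownwardEdge, ← twoRhoPairing_cast]
  norm_cast

variable [P.IsReduced]

/-- The simple reflection s_j permutes the positive roots other than j and negates their pairings
with j^∨, so these terms cancel. -/
lemma twoRhoPairing_of_mem_support {j : ι} (hj : j ∈ b.support) : twoRhoPairing b j = 2 := by
  classical
  have hpos : b.IsPos j := Base.isPos_of_mem_support hj
  rw [twoRhoPairing, ← Finset.add_sum_erase _ _ (Finset.mem_filter.2 ⟨Finset.mem_univ j, hpos⟩),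
    P.pairingIn_same ℤ, add_eq_left]
  have hneg (a : ι) : P.pairingIn ℤ (P.reflectionPerm j a) j = - P.pairingIn ℤ a j := by
    rw [← pairingIn_reflectionPerm, pairingIn_reflectionPerm_self_right]
  refine Finset.sum_involution (fun a _ ↦ P.reflectionPerm j a) ?_ ?_ ?_ ?_
  · intro a _
    rw [hneg, add_neg_cancel]
  · intro a _ h0 h
    have := hneg a
    rw [h] at this
    lia
  · intro a ha
    simp only [Finset.mem_erase, Finset.mem_filter, Finset.mem_univ, true_and] at ha ⊢
    refine ⟨fun h ↦ ?_, ha.2.reflectionPerm hj ha.1⟩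
    have h' : a = P.reflectionPerm j j := (P.reflectionPerm_self j a).symm.trans (congrArg _ h)
    exact (isPos_neg_iff b j).1 (h' ▸ ha.2) hpos
  · intro a _
    exact P.reflectionPerm_self j a

lemma length_ofIdx_reflectionPerm_le {j : ι} (hj : j ∈ b.support) (i : ι) :
    length b (weylGroup.ofIdx P i) ≤ length b (weylGroup.ofIdx P (P.reflectionPerm j i)) + 2 := by
  have h : weylGroup.ofIdx P i =
      weylGroup.ofIdx P j * weylGroup.ofIdx P (P.reflectionPerm j i) * weylGroup.ofIdx P j := by
    rw [← ofIdx_reflectionPerm, reflectionPerm_self]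
  have h₁ := length_mul_le b
    (weylGroup.ofIdx P j * weylGroup.ofIdx P (P.reflectionPerm j i)) (weylGroup.ofIdx P j)
  have h₂ := length_mul_le b (weylGroup.ofIdx P j) (weylGroup.ofIdx P (P.reflectionPerm j i))
  have h₃ := length_ofIdx_le_one b hj
  rw [← h] at h₁
  lia

/-- The length of a reflection is bounded by `⟨2ρ, β^∨⟩ - 1`. -/
lemma length_ofIdx_lt {β : ι} (hβ : b.IsPos β) :
    (length b (weylGroup.ofIdx P β) : ℤ) < twoRhoPairing b β := by
  refine isPos_induction_on_simple (b := b)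
    (p := fun β ↦ (length b (weylGroup.ofIdx P β) : ℤ) < twoRhoPairing b β) ?_ ?_ hβ
  · intro i hi
    have := length_ofIdx_le_one b hi
    rw [twoRhoPairing_of_mem_support b hi]
    lia
  · intro i j hi hj hk hc ih
    -- From s_j β to β the length grows by at most 2, the pairing by 2⟨α_j, β^∨⟩ ≥ 2.
    have h₁ := length_ofIdx_reflectionPerm_le b hj i
    rw [twoRhoPairing_reflectionPerm, twoRhoPairing_of_mem_support b hj] at ih
    lia

lemma twoRhoPairing_pos {β : ι} (hβ : b.IsPos β) : 0 < twoRhoPairing b β :=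
  (Int.natCast_nonneg _).trans_lt (length_ofIdx_lt b hβ)

/-- A positive root `α` inverted by the reflection in a quantum root `β` is `β` itself or satisfies
`⟨α, β^∨⟩ = 1`. -/
lemma eq_or_pairingIn_eq_one_of_quantum {β : ι} (hβ : b.IsPos β)
    (hq : (length b (weylGroup.ofIdx P β) : ℤ) + 1 = twoRhoPairing b β) {α : ι} (hα : b.IsPos α)
    (h : ¬ b.IsPos (P.reflectionPerm β α)) : α = β ∨ P.pairingIn ℤ α β = 1 := by
  revert hq α
  refine isPos_induction_on_simple (b := b)
    (p := fun β ↦ (length b (weylGroup.ofIdx P β) : ℤ) + 1 = twoRhoPairing b β → ∀ {α : ι},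
      b.IsPos α → ¬ b.IsPos (P.reflectionPerm β α) → α = β ∨ P.pairingIn ℤ α β = 1) ?_ ?_ hβ
  · intro i hi _ α hα h
    by_contra! hne
    exact h (hα.reflectionPerm hi hne.1)
  · intro β j hβ hj hk hc ih hq α hα h
    have h₁ := length_ofIdx_reflectionPerm_le b hj β
    have h₂ := length_ofIdx_lt b hk
    have h₃ := twoRhoPairing_reflectionPerm b j β
    rw [twoRhoPairing_of_mem_support b hj] at h₃
    -- Equality for β leaves no slack in these bounds; it also makes s_j β quantum.
    have hc1 : P.pairingIn ℤ j β = 1 := by lia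
    rcases eq_or_ne α j with rfl | hαj
    · exact Or.inr hc1
    -- ν = -s_β α has the same pairing with β^∨ as α. If ν ≠ j then s_j ν > 0, so s_j β inverts s_j
    -- α.
    set ν := P.reflectionPerm (P.reflectionPerm β α) (P.reflectionPerm β α) with hν
    have hνpos : b.IsPos ν := (isPos_neg_iff b _).2 h
    rcases eq_or_ne ν j with hνj | hνj
    · right
      rw [← hνj, hν, pairingIn_reflectionPerm_self_left, ← pairingIn_reflectionPerm,
        pairingIn_reflectionPerm_self_right, neg_neg] at hc1
      exact hc1
    have key := ih (by lia) (hα.reflectionPerm hj hαj) ?_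
    · rcases key with h | h
      · exact Or.inl ((P.reflectionPerm j).injective h)
      · rw [← pairingIn_reflectionPerm, reflectionPerm_self] at h
        exact Or.inr h
    · have e : P.reflectionPerm (P.reflectionPerm j β) (P.reflectionPerm j α) =
          P.reflectionPerm j (P.reflectionPerm β α) := by
        simp only [← ofIdx_smul_idx (P := P), ← mul_smul]
        rw [ofIdx_smul]
      rw [e, ← isPos_neg_iff, ← ofIdx_smul_idx (P := P) j, ← smul_reflectionPerm_self]
      exact hνpos.reflectionPerm hj hνj

end
-- Factoring s_β s_α and rewriting paths
section

variable {ι K M N : Type*} [Fintype ι] [Field K] [CharZero K]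
  [AddCommGroup M] [Module K M] [AddCommGroup N] [Module K N]
  {P : RootPairing ι K M N} [P.IsCrystallographic] [P.IsReduced] (b : P.Base)

/-- The coroot of s_α β is β^∨ - α^∨, so s_β s_α = s_α s_{s_α β} works with equality if s_α β > 0.
Otherwise take θ = -s_α β and s_θ s_{s_θ α}: with k = ⟨β, α^∨⟩ the coroots sum to β^∨ + (2 - k)θ^∨,
and k ≥ 2. The second height hypothesis makes s_θ α positive. -/
lemma exists_mul_ofIdx_eq_of_height_lt {α β : ι} (hα : b.IsPos α)
    (h1 : P.pairingIn ℤ α β = 1) (hlt : b.height α < b.height β)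
    (hlt' : (P.pairingIn ℤ β α - 1) * b.height α < b.height β) (hk : 1 ≤ P.pairingIn ℤ β α) :
    ∃ x y : ι, b.IsPos x ∧ b.IsPos y ∧
      weylGroup.ofIdx P β * weylGroup.ofIdx P α = weylGroup.ofIdx P x * weylGroup.ofIdx P y ∧
      twoRhoPairing b x + twoRhoPairing b y ≤ twoRhoPairing b β := by
  have hδ := twoRhoPairing_reflectionPerm b α β
  have hδht := height_reflectionPerm b α β
  rw [h1] at hδ
  by_cases hpos : b.IsPos (P.reflectionPerm α β)
  · refine ⟨α, P.reflectionPerm α β, hα, hpos, ?_, by lia⟩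
    rw [ofIdx_reflectionPerm, mul_assoc, ofIdx_mul_self_assoc]
  · set θ := P.reflectionPerm (P.reflectionPerm α β) (P.reflectionPerm α β) with hθ
    have hθpos : b.IsPos θ := (isPos_neg_iff b _).2 hpos
    have hsθ : weylGroup.ofIdx P θ =
        weylGroup.ofIdx P α * weylGroup.ofIdx P β * weylGroup.ofIdx P α := by
      rw [hθ, ofIdx_neg, ofIdx_reflectionPerm]
    have hθρ : twoRhoPairing b θ = twoRhoPairing b α - twoRhoPairing b β := by
      rw [hθ, twoRhoPairing_neg, hδ]
      ring
    have hθht : b.height θ = P.pairingIn ℤ β α * b.height α - b.height β := by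
      rw [hθ, height_neg, hδht]
      ring
    have hαθ : P.pairingIn ℤ α θ = 1 := by
      rw [hθ, pairingIn_reflectionPerm_self_right, pairingIn_reflectionPerm,
        pairingIn_reflectionPerm_self_left, neg_neg, h1]
    have hθα : P.pairingIn ℤ θ α = P.pairingIn ℤ β α := by
      rw [hθ, pairingIn_reflectionPerm_self_left, ← pairingIn_reflectionPerm,
        pairingIn_reflectionPerm_self_right, neg_neg]
    have hηρ := twoRhoPairing_reflectionPerm b θ α
    have hηht := height_reflectionPerm b θ α
    rw [hαθ] at hηht
    rw [hθα] at hηρ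
    have hηpos : b.IsPos (P.reflectionPerm θ α) := by
      rw [Base.isPos_iff]
      lia
    have h2 : 2 ≤ P.pairingIn ℤ β α := by
      by_contra hcon
      have : P.pairingIn ℤ β α = 1 := by lia
      rw [Base.isPos_iff, hδht, this] at hpos
      lia
    refine ⟨θ, P.reflectionPerm θ α, hθpos, hηpos, ?_, ?_⟩
    · rw [ofIdx_reflectionPerm α θ, mul_assoc, ofIdx_mul_self_assoc, hsθ, mul_assoc,
        ofIdx_mul_self_assoc]
    · have := twoRhoPairing_pos b hθpos
      nlinarith

/-- If `⟨α, β^∨⟩ = 1` and `s_β α` is negative, then `s_β s_α` factors into two reflections whose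
total `⟨2ρ, ·^∨⟩` does not exceed that of `β`. -/
lemma exists_mul_ofIdx_eq {α β : ι} (hα : b.IsPos α)
    (h1 : P.pairingIn ℤ α β = 1) (hneg : ¬ b.IsPos (P.reflectionPerm β α)) :
    ∃ x y : ι, b.IsPos x ∧ b.IsPos y ∧
      weylGroup.ofIdx P β * weylGroup.ofIdx P α = weylGroup.ofIdx P x * weylGroup.ofIdx P y ∧
      twoRhoPairing b x + twoRhoPairing b y ≤ twoRhoPairing b β := by
  -- γ = β - α can replace α, as s_γ s_β = s_β s_α; one of the two meets the height condition.
  set γ := P.reflectionPerm (P.reflectionPerm β α) (P.reflectionPerm β α) with hγ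
  have hγpos : b.IsPos γ := (isPos_neg_iff b _).2 hneg
  have hγht : b.height γ = b.height β - b.height α := by
    rw [hγ, height_neg, height_reflectionPerm, h1]
    ring
  have hγβ : P.pairingIn ℤ γ β = 1 := by
    rw [hγ, pairingIn_reflectionPerm_self_left, ← pairingIn_reflectionPerm,
      pairingIn_reflectionPerm_self_right, neg_neg, h1]
  have hβγ : P.pairingIn ℤ β γ = P.pairingIn ℤ β α := by
    rw [hγ, pairingIn_reflectionPerm_self_right, pairingIn_reflectionPerm,
      pairingIn_reflectionPerm_self_left, neg_neg]
  have hk : P.pairingIn ℤ β α = 1 ∨ P.pairingIn ℤ β α = 2 ∨ P.pairingIn ℤ β α = 3 := by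
    have := P.pairingIn_pairingIn_mem_set_of_isCrystal_of_isRed α β
    simp only [h1, Set.mem_insert_iff, Set.mem_singleton_iff, Prod.mk.injEq] at this
    lia
  have hαht := (Base.isPos_iff b).1 hα
  have hγht' := (Base.isPos_iff b).1 hγpos
  by_cases hlt : (P.pairingIn ℤ β α - 1) * b.height α < b.height β
  · exact exists_mul_ofIdx_eq_of_height_lt b hα h1 (by lia) hlt (by lia)
  have hlt' : (P.pairingIn ℤ β γ - 1) * b.height γ < b.height β := by
    rw [hβγ]
    rcases hk with hk | hk | hk <;> rw [hk] at hlt ⊢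
    · lia
    · lia
    -- Both could fail only if α and γ had equal height, but here γ - α = β - 2α is a root.
    · have h := b.height_ne_zero (P.reflectionPerm (P.reflectionPerm α β) α)
      rw [height_reflectionPerm, height_reflectionPerm, hk, pairingIn_reflectionPerm,
        pairingIn_reflectionPerm_self_left, h1] at h
      lia
  obtain ⟨x, y, hx, hy, he, hle⟩ :=
    exists_mul_ofIdx_eq_of_height_lt b hγpos hγβ (by lia) hlt' (by lia)
  refine ⟨y, x, hy, hx, ?_, by lia⟩
  have he' := congrArg (·⁻¹) he
  simp only [mul_inv_rev, ofIdx_inv] at he'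
  rw [← he', hγ, ofIdx_neg, ofIdx_reflectionPerm, mul_assoc, mul_assoc, ofIdx_mul_self, mul_one]

lemma exists_downward_path (w : P.weylGroup) : ∃ n, HasPath (downwardGraph b) w 1 n := by
  generalize hn : length b w = n
  induction n using Nat.strong_induction_on generalizing w with
  | h n ih =>
    obtain ⟨l, hl, rfl, hlen⟩ := exists_reduced_word b w
    rcases l.eq_nil_or_concat with rfl | ⟨t, j, rfl⟩
    · exact ⟨0, HasPath.nil _⟩
    rw [List.concat_eq_append] at *
    simp only [List.mem_append, List.mem_singleton, or_imp, forall_and, forall_eq] at hl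
    set v := (t.map (weylGroup.ofIdx P)).prod with hv
    have hw : ((t ++ [j]).map (weylGroup.ofIdx P)).prod = v * weylGroup.ofIdx P j := by simp [hv]
    rw [hw] at hn hlen ⊢
    have h₁ : length b v ≤ t.length := length_prod_le b hl.1
    have h₂ := length_mul_le b v (weylGroup.ofIdx P j)
    have h₃ := length_ofIdx_le_one b hl.2
    rw [List.length_append, List.length_singleton] at hlen
    obtain ⟨m, hm⟩ := ih (length b v) (by lia) v rfl
    refine ⟨m + 1, HasPath.cons ?_ hm⟩
    refine (isDownwardEdge_iff b).2 ⟨j, Base.isPos_of_mem_support hl.2, ?_, ?_⟩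
    · rw [mul_assoc, ofIdx_mul_self, mul_one]
    · rw [twoRhoPairing_of_mem_support b hl.2]
      lia

/-- Prepending an upward edge to a downward path, one can replace the result by a downward path
which is not longer. -/
lemma exists_downward_path_of_upward_edge {m : ℕ} {w v : P.weylGroup} (h : IsUpwardEdge b w v)
    (hp : HasPath (downwardGraph b) v 1 m) :
    ∃ n ≤ m + 1, HasPath (downwardGraph b) w 1 n := by
  induction m generalizing w v with
  | zero =>
    cases hp
    obtain ⟨α, -, -, hlen⟩ := h
    rw [length_one] at hlen
    lia
  | succ m ih =>
    cases hp with | @cons _ u _ _ hd hp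
    obtain ⟨α, hα, rfl, hlen⟩ := h
    obtain ⟨β, hβ, hu, hq⟩ := (isDownwardEdge_iff b).1 hd
    have hv : w * weylGroup.ofIdx P α = u * weylGroup.ofIdx P β := by
      rw [hu, mul_assoc, ofIdx_mul_self, mul_one]
    have hw : w = u * weylGroup.ofIdx P β * weylGroup.ofIdx P α := by
      rw [← hv, mul_assoc, ofIdx_mul_self, mul_one]
    rw [hv] at hlen hq
    have hβlen := length_ofIdx_lt b hβ
    have hmul := length_mul_le b u (weylGroup.ofIdx P β)
    have hneg : ¬ b.IsPos ((u * weylGroup.ofIdx P β) • α) :=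
      not_isPos_smul_of_length_lt b hα (by rw [← hw]; lia)
    by_cases hs : b.IsPos (P.reflectionPerm β α)
    · -- the label `s_β α` is inverted by `u`, and the two edges can be swapped
      have hw' : w = u * weylGroup.ofIdx P (P.reflectionPerm β α) * weylGroup.ofIdx P β := by
        rw [hw, mul_assoc, mul_assoc, ← ofIdx_smul_idx, ofIdx_smul]
      set u' := u * weylGroup.ofIdx P (P.reflectionPerm β α) with hu'
      have hlt : length b u' < length b u := by
        refine length_mul_ofIdx_lt b hs ?_
        rwa [mul_smul, ofIdx_smul_idx] at hneg
      -- ℓ(u) + ⟨2ρ, β^∨⟩ - 2 = ℓ(w) ≤ ℓ(u') + ℓ(s_β) forces ℓ(u') = ℓ(u) - 1.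
      have hmul' := length_mul_le b u' (weylGroup.ofIdx P β)
      rw [← hw'] at hmul'
      obtain ⟨n, hn, hpath⟩ := ih (w := u') (v := u) ⟨_, hs,
        by rw [hu', mul_assoc, ofIdx_mul_self, mul_one], by lia⟩ hp
      refine ⟨n + 1, by lia, HasPath.cons ?_ hpath⟩
      refine (isDownwardEdge_iff b).2 ⟨β, hβ, ?_, by lia⟩
      rw [hw', mul_assoc, ofIdx_mul_self, mul_one]
    · rcases eq_or_pairingIn_eq_one_of_quantum b hβ (by lia) hα hs with rfl | h1
      · rw [mul_assoc, ofIdx_mul_self, mul_one] at hw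
        exact ⟨m, by lia, hw ▸ hp⟩
      · obtain ⟨x, y, hx, hy, he, hle⟩ := exists_mul_ofIdx_eq b hα h1 hs
        -- Now ℓ(w) = ℓ(u) + ⟨2ρ, β^∨⟩ - 2 is at least the largest value that s_x and s_y allow, so
        -- every bound below is an equality.
        rw [mul_assoc, he, ← mul_assoc] at hw
        have h₁ := length_mul_le b u (weylGroup.ofIdx P x)
        have h₂ := length_mul_le b (u * weylGroup.ofIdx P x) (weylGroup.ofIdx P y)
        have h₃ := length_ofIdx_lt b hx
        have h₄ := length_ofIdx_lt b hy
        rw [← hw] at h₂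
        refine ⟨m + 1 + 1, le_rfl, HasPath.cons (v := u * weylGroup.ofIdx P x) ?_
          (HasPath.cons ?_ hp)⟩
        · refine (isDownwardEdge_iff b).2 ⟨y, hy, ?_, by lia⟩
          rw [hw, mul_assoc, ofIdx_mul_self, mul_one]
        · refine (isDownwardEdge_iff b).2 ⟨x, hx, ?_, by lia⟩
          rw [mul_assoc, ofIdx_mul_self, mul_one]

lemma exists_downward_path_of_path {n : ℕ} {w : P.weylGroup}
    (hp : HasPath (quantumBruhatGraph b) w 1 n) :
    ∃ m ≤ n, HasPath (downwardGraph b) w 1 m := by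
  induction n generalizing w with
  | zero =>
    cases hp
    exact ⟨0, le_rfl, HasPath.nil _⟩
  | succ n ih =>
    cases hp with | cons h hp
    obtain ⟨m, hm, hpath⟩ := ih hp
    rcases h with h | h
    · obtain ⟨k, hk, hk'⟩ := exists_downward_path_of_upward_edge b h hpath
      exact ⟨k, by lia, hk'⟩
    · exact ⟨m + 1, by lia, HasPath.cons h hpath⟩

end

/-! ### From paths to distances -/

lemma HasPath.mono {V : Type*} {G H : Digraph V} (h : ∀ u v, G.Adj u v → H.Adj u v) {u v : V}
    {n : ℕ} (hp : HasPath G u v n) : HasPath H u v n := by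
  induction hp with
  | nil u => exact HasPath.nil u
  | cons hadj _ ih => exact HasPath.cons (h _ _ hadj) ih

lemma pathDist_le {V : Type*} {G : Digraph V} {u v : V} {n : ℕ} (hp : HasPath G u v n) :
    pathDist G u v ≤ n :=
  iInf₂_le n hp

end QuantumBruhat

theorem proposition4p10 {ι K M N : Type*} [Fintype ι] [Field K] [CharZero K]
    [AddCommGroup M] [Module K M] [AddCommGroup N] [Module K N]
    (P : RootPairing ι K M N) [P.IsRootSystem] [P.IsCrystallographic] [P.IsReduced]
    (b : P.Base) (w : P.weylGroup) :
    QuantumBruhat.pathDist (QuantumBruhat.quantumBruhatGraph b) w 1 =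
        QuantumBruhat.pathDist (QuantumBruhat.downwardGraph b) w 1 ∧
      QuantumBruhat.pathDist (QuantumBruhat.downwardGraph b) w 1 ≠ ⊤ := by
  refine ⟨le_antisymm ?_ ?_, ?_⟩
  · exact le_iInf₂ fun n hp ↦ QuantumBruhat.pathDist_le (hp.mono fun _ _ ↦ Or.inr)
  · refine le_iInf₂ fun n hp ↦ ?_
    obtain ⟨m, hm, hpath⟩ := QuantumBruhat.exists_downward_path_of_path b hp
    exact (QuantumBruhat.pathDist_le hpath).trans (by exact_mod_cast hm)
  · obtain ⟨n, hp⟩ := QuantumBruhat.exists_downward_path b w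
    exact ne_top_of_le_ne_top (ENat.natCast_ne_top n) (QuantumBruhat.pathDist_le hp)
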